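/- Let $\alpha:\mathbb N\to\mathbb N$. For $w>0$ (and $n,\alpha(n)\ge1$) let $x_{n,\alpha}(w)$ be the unique positive solution of $$\sum_{j=1}^{\alpha(n)} x_{n,\alpha}(w)^j=\frac nw,$$ let $x'_{n,\alpha}$ be its derivative with respect to $w$, and put $$m_{n,\alpha}:=\sum_{j=1}^{\alpha(n)}\frac{x_{n,\alpha}(1)^j}{j},\qquad v_{n,\alpha}:=m_{n,\alpha}+n\,\frac{x'_{n,\alpha}(1)}{x_{n,\alpha}(1)}.$$ (These are the asymptotic mean and variance of the number of cycles of a uniform random permutation of $n$ elements without cycles longer than $\alpha(n)$.) For $u>0$, $u\ne1$, let $\xi(u)$ be the nonzero solution of $e^{\xi}=1+u\xi$, and let $\xi(1)=0$. For functions $\phi_k$ with $\phi_{k+1}(n)=o(\phi_k(n))$ as $n\to\infty$ for all $k\ge k_0$, write $f(n)\sim\sum_{k\ge k_0}a_k\phi_k(n)$ if $f(n)=\sum_{k=k_0}^{N}a_k\phi_k(n)+o(\phi_N(n))$ as $n\to\infty$ for every $N\ge k_0$. Theorem 2 (quantitative). Suppose that there are $\alpha_0,\alpha_1\in(0,1)$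 with $\lim_{n\to\infty}n^{-\alpha_0}\alpha(n)=\infty$ and $\lim_{n\to\infty}n^{-\alpha_1}\alpha(n)=0$. Then, as $n\to\infty$, with respect to the functions $\phi_k(n)=\frac{n}{\alpha(n)}\,\xi\!\left(\frac n{\alpha(n)}\right)^{-k}$, there are the asymptotic expansions $$m_{n,\alpha}\sim\frac{n}{\alpha(n)}\sum_{k=0}^\infty\frac{k!}{\xi\left(\frac n{\alpha(n)}\right)^k}\qquad\text{and}\qquad v_{n,\alpha}\sim\frac{n}{\alpha(n)}\sum_{k=2}^\infty\frac{k!-1}{\xi\left(\frac n{\alpha(n)}\right)^k}.$$ In particular $v_{n,\alpha}=o(m_{n,\alpha})$, so that $m_{n,\alpha}$ and $v_{n,\alpha}$ are of different orders. -/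

import Mathlib

open Filter Topology Asymptotics

namespace CycleRestricted

noncomputable section

/-- `∑_{k ≥ k₀} a k * φ k` is an asymptotic expansion of `f` along the filter `l`: the functions
`φ k` form an asymptotic scale, and for every `N ≥ k₀` the partial sum up to `N` approximates `f`
up to `o(φ N)`. -/
def IsAsymptoticExpansion {ι : Type*} (l : Filter ι) (f : ι → ℝ) (k₀ : ℕ) (a : ℕ → ℝ)
    (φ : ℕ → ι → ℝ) : Prop :=
  (∀ k, k₀ ≤ k → φ (k + 1) =o[l] φ k) ∧
    ∀ N, k₀ ≤ N → (fun z => f z - ∑ k ∈ Finset.Icc k₀ N, a k * φ k z) =o[l] φ N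

/-- The function `x_{n,α}` of `w`: the unique positive solution `x` of
`∑_{j=1}^{α(n)} x^j = n / w` (it exists and is unique for `n, α(n) ≥ 1` and `w > 0`, see
`saddle_existsUnique`; the infimum is over that singleton). -/
def saddle (α : ℕ → ℕ) (n : ℕ) (w : ℝ) : ℝ :=
  sInf {x : ℝ | 0 < x ∧ ∑ j ∈ Finset.Icc 1 (α n), x ^ j = (n : ℝ) / w}

/-- `m_{n,α} = ∑_{j=1}^{α(n)} x_{n,α}(1)^j / j`. -/
def mean (α : ℕ → ℕ) (n : ℕ) : ℝ :=
  ∑ j ∈ Finset.Icc 1 (α n), saddle α n 1 ^ j / (j : ℝ)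

/-- `v_{n,α} = m_{n,α} + n x'_{n,α}(1) / x_{n,α}(1)`, where the derivative is with respect to `w`
(it exists, see `saddle_differentiableAt`). -/
def var (α : ℕ → ℕ) (n : ℕ) : ℝ :=
  mean α n + (n : ℝ) * (deriv (fun w : ℝ => saddle α n w) 1 / saddle α n 1)

/-- `ξ(u)` is the nonzero solution of `exp ξ = 1 + u ξ` (existing and unique for `u > 0`, `u ≠ 1`,
see `xi_existsUnique`; the infimum is over that singleton), and `ξ(1) = 0`. -/
def xi (u : ℝ) : ℝ :=
  if u = 1 then 0 else sInf {t : ℝ | t ≠ 0 ∧ Real.exp t = 1 + u * t}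

/-! The defining equations have the unique solutions claimed above, and `x_{n,α}` is
differentiable. -/

theorem sum_pow_lt {a : ℕ} (ha : 1 ≤ a) {x y : ℝ} (hx : 0 < x) (hxy : x < y) :
    ∑ j ∈ Finset.Icc 1 a, x ^ j < ∑ j ∈ Finset.Icc 1 a, y ^ j := by
  refine Finset.sum_lt_sum_of_nonempty ⟨1, by simp [ha]⟩ fun j hj => ?_
  have := (Finset.mem_Icc.1 hj).1
  exact pow_lt_pow_left₀ hxy hx.le (by omega)

theorem sum_pow_existsUnique {a : ℕ} (ha : 1 ≤ a) {c : ℝ} (hc : 0 < c) :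
    ∃! x : ℝ, 0 < x ∧ ∑ j ∈ Finset.Icc 1 a, x ^ j = c := by
  have h0 : ∑ j ∈ Finset.Icc 1 a, (0 : ℝ) ^ j = 0 := by
    refine Finset.sum_eq_zero fun j hj => ?_
    have := (Finset.mem_Icc.1 hj).1
    exact zero_pow (by omega)
  have h1 : c ≤ ∑ j ∈ Finset.Icc 1 a, c ^ j := by
    have := Finset.single_le_sum (f := fun j => c ^ j) (s := Finset.Icc 1 a)
      (fun j _ => by positivity) (Finset.mem_Icc.2 ⟨le_refl 1, ha⟩)
    simpa using this
  obtain ⟨x, hx, hxc⟩ := intermediate_value_Icc (f := fun x : ℝ => ∑ j ∈ Finset.Icc 1 a, x ^ j)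
    hc.le (by fun_prop) (show c ∈ Set.Icc _ _ from ⟨by simpa only [h0] using hc.le, h1⟩)
  have hxc' : ∑ j ∈ Finset.Icc 1 a, x ^ j = c := hxc
  have hx0 : 0 < x := by
    rcases hx.1.eq_or_lt with h | h
    · rw [← h, h0] at hxc'
      exact absurd hxc' hc.ne
    · exact h
  refine ⟨x, ⟨hx0, hxc'⟩, fun y hy => ?_⟩
  rcases lt_trichotomy y x with h | h | h
  · have := sum_pow_lt ha hy.1 h
    linarith [hy.2]
  · exact h
  · have := sum_pow_lt ha hx0 h
    linarith [hy.2]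

theorem saddle_existsUnique {α : ℕ → ℕ} {n : ℕ} (hn : 1 ≤ n) (ha : 1 ≤ α n) {w : ℝ}
    (hw : 0 < w) : ∃! x : ℝ, 0 < x ∧ ∑ j ∈ Finset.Icc 1 (α n), x ^ j = (n : ℝ) / w :=
  sum_pow_existsUnique ha (div_pos (by exact_mod_cast hn) hw)

theorem saddle_eq_of {α : ℕ → ℕ} {n : ℕ} (hn : 1 ≤ n) (ha : 1 ≤ α n) {w : ℝ} (hw : 0 < w) {x : ℝ}
    (hx : 0 < x) (hs : ∑ j ∈ Finset.Icc 1 (α n), x ^ j = (n : ℝ) / w) : saddle α n w = x := by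
  have : {x : ℝ | 0 < x ∧ ∑ j ∈ Finset.Icc 1 (α n), x ^ j = (n : ℝ) / w} = {x} := by
    ext y
    exact ⟨fun hy => (saddle_existsUnique hn ha hw).unique hy ⟨hx, hs⟩,
      fun hy => by rw [Set.mem_singleton_iff.1 hy]; exact ⟨hx, hs⟩⟩
  rw [saddle, this, csInf_singleton]

theorem saddle_spec {α : ℕ → ℕ} {n : ℕ} (hn : 1 ≤ n) (ha : 1 ≤ α n) {w : ℝ} (hw : 0 < w) :
    0 < saddle α n w ∧ ∑ j ∈ Finset.Icc 1 (α n), saddle α n w ^ j = (n : ℝ) / w := by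
  obtain ⟨x, hx, -⟩ := saddle_existsUnique hn ha hw
  rwa [saddle_eq_of hn ha hw hx.1 hx.2]

theorem saddle_differentiableAt {α : ℕ → ℕ} {n : ℕ} (hn : 1 ≤ n) (ha : 1 ≤ α n) {w : ℝ}
    (hw : 0 < w) : DifferentiableAt ℝ (fun w : ℝ => saddle α n w) w := by
  obtain ⟨hx, hs⟩ := saddle_spec hn ha hw
  set x := saddle α n w with hxdef
  let S : ℝ → ℝ := fun t => ∑ j ∈ Finset.Icc 1 (α n), t ^ j
  have hS : HasStrictDerivAt S (∑ j ∈ Finset.Icc 1 (α n), (j : ℝ) * x ^ (j - 1)) x :=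
    HasStrictDerivAt.fun_sum fun j _ => hasStrictDerivAt_pow j x
  have hne : (∑ j ∈ Finset.Icc 1 (α n), (j : ℝ) * x ^ (j - 1)) ≠ 0 := by
    refine (Finset.sum_pos (fun j hj => ?_) ⟨1, by simp [ha]⟩).ne'
    have : 0 < j := (Finset.mem_Icc.1 hj).1
    positivity
  have hright := (hS.hasStrictFDerivAt_equiv hne).eventually_right_inverse
  have hg := (hS.to_localInverse hne)
  have hgx : hS.localInverse S _ x hne (S x) = x :=
    (hS.hasStrictFDerivAt_equiv hne).localInverse_apply_image
  set g := hS.localInverse S _ x hne with hgdef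
  have hSx : S x = (n : ℝ) / w := hs
  have hdiv : DifferentiableAt ℝ (fun t : ℝ => (n : ℝ) / t) w :=
    (differentiableAt_const _).div differentiableAt_id hw.ne'
  have hpos : ∀ᶠ y in 𝓝 (S x), 0 < g y :=
    hg.hasDerivAt.continuousAt.eventually (by rw [hgx]; exact lt_mem_nhds hx)
  have htend : Tendsto (fun t : ℝ => (n : ℝ) / t) (𝓝 w) (𝓝 (S x)) := by
    rw [hSx]; exact hdiv.continuousAt
  have heq : (fun t : ℝ => saddle α n t) =ᶠ[𝓝 w] fun t => g ((n : ℝ) / t) := by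
    filter_upwards [htend.eventually hpos, htend.eventually hright, lt_mem_nhds hw]
      with t h1 h2 h3
    exact saddle_eq_of hn ha h3 h1 h2
  refine DifferentiableAt.congr_of_eventuallyEq ?_ heq
  have hgd : DifferentiableAt ℝ g ((n : ℝ) / w) := hSx ▸ hg.hasDerivAt.differentiableAt
  exact hgd.comp w hdiv

theorem xi_existsUnique {u : ℝ} (hu : 0 < u) (hu1 : u ≠ 1) :
    ∃! t : ℝ, t ≠ 0 ∧ Real.exp t = 1 + u * t := by
  let f : ℝ → ℝ := fun t => Real.exp t - (1 + u * t)
  have hf : Continuous f := by fun_prop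
  have hlow : f (Real.log u) < 0 := by
    have h := Real.log_lt_sub_one_of_pos (inv_pos.2 hu) (by simpa using hu1)
    rw [Real.log_inv] at h
    have h2 := mul_lt_mul_of_pos_left h hu
    have h3 : u * (u⁻¹ - 1) = 1 - u := by field_simp
    simp only [f, Real.exp_log hu]
    linarith
  have hex : ∃ t : ℝ, t ≠ 0 ∧ Real.exp t = 1 + u * t := by
    rcases lt_or_gt_of_ne hu1 with h | h
    · have hlog : Real.log u < 0 := Real.log_neg hu h
      have hle : -u⁻¹ ≤ Real.log u := by
        have := Real.one_sub_inv_le_log_of_pos hu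
        linarith
      have hhi : 0 < f (-u⁻¹) := by
        have : u * -u⁻¹ = -1 := by field_simp
        simp only [f, this]
        have := Real.exp_pos (-u⁻¹)
        linarith
      obtain ⟨t, ht, h0⟩ := intermediate_value_Icc' hle hf.continuousOn ⟨hlow.le, hhi.le⟩
      exact ⟨t, (ht.2.trans_lt hlog).ne, sub_eq_zero.1 h0⟩
    · have hlog : 0 < Real.log u := Real.log_pos h
      have hle : Real.log u ≤ 2 * u := by
        have := Real.log_le_sub_one_of_pos hu
        linarith
      have hhi : 0 < f (2 * u) := by
        have := Real.quadratic_le_exp_of_nonneg (show 0 ≤ 2 * u by linarith)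
        simp only [f]
        nlinarith
      obtain ⟨t, ht, h0⟩ := intermediate_value_Icc hle hf.continuousOn ⟨hlow.le, hhi.le⟩
      exact ⟨t, (hlog.trans_le ht.1).ne', sub_eq_zero.1 h0⟩
  have key : ∀ s t : ℝ, s ≠ 0 → Real.exp s = 1 + u * s → t ≠ 0 → Real.exp t = 1 + u * t →
      ¬ s < t := by
    intro s t hs0 hs ht0 ht hst
    have := strictConvexOn_exp.secant_strict_mono (Set.mem_univ 0) (Set.mem_univ s)
      (Set.mem_univ t) hs0 ht0 hst
    simp only [hs, ht, Real.exp_zero, add_sub_cancel_left, sub_zero] at this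
    rw [mul_div_cancel_right₀ _ hs0, mul_div_cancel_right₀ _ ht0] at this
    exact lt_irrefl _ this
  obtain ⟨t, ht0, ht⟩ := hex
  exact ⟨t, ⟨ht0, ht⟩, fun s hs => le_antisymm (not_lt.1 (key t s ht0 ht hs.1 hs.2))
    (not_lt.1 (key s t hs.1 hs.2 ht0 ht))⟩

theorem xi_spec {u : ℝ} (hu : 0 < u) (hu1 : u ≠ 1) :
    xi u ≠ 0 ∧ Real.exp (xi u) = 1 + u * xi u := by
  obtain ⟨t, ht, huniq⟩ := xi_existsUnique hu hu1
  have : {t : ℝ | t ≠ 0 ∧ Real.exp t = 1 + u * t} = {t} := by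
    ext y
    exact ⟨fun hy => huniq y hy, fun hy => by rw [Set.mem_singleton_iff.1 hy]; exact ht⟩
  rwa [xi, if_neg hu1, this, csInf_singleton]

end

end CycleRestricted

/-!
Write `a = α(n)`, `u = n / a`, `x = x_{n,α}(1)` and `σ = a (1 - 1 / x)`. Summing the geometric
series turns the saddle point equation into `x ^ a = 1 + u σ`, while `e ^ ξ = 1 + u ξ`. Since
`x ^ a = e ^ (a log x)` and `a log x = σ + O(ξ² / a)`, the quantities `1 / σ` and `1 / ξ` differ by
an error smaller than every power of `1 / ξ`. Up to such errors:

* with `A_k = (a ^ k / u) ∑_{j > a / 2} x ^ j / (j (j + 1) ⋯ (j + k))`, the mean is `u A_0`, and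
  summation by parts gives `A_k = 1 + (k + 1) ξ⁻¹ A_{k+1}`; iterating this yields `∑ k! ξ⁻ᵏ`;
* implicit differentiation gives `v = m - u G` with `G = n a / ∑ j x ^ j`, and summation by parts
  gives `G = 1 + ξ⁻¹ G`, so that `G` expands into the geometric series `∑ ξ⁻ᵏ`.
-/

namespace CycleRestricted

section Superpolynomial

variable {ι : Type*} {l : Filter ι} {κ κ' f g : ι → ℝ}

theorem superpolynomialDecay_of_isBigO (hf : SuperpolynomialDecay l κ f) (hκ : κ' =O[l] κ)
    (hg : g =O[l] f) : SuperpolynomialDecay l κ' g := fun n =>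
  ((hκ.pow n).mul hg).trans_tendsto (hf n)

theorem superpolynomialDecay_mul_isBigO_one (hf : SuperpolynomialDecay l κ f)
    (hg : g =O[l] fun _ => (1 : ℝ)) : SuperpolynomialDecay l κ fun i => f i * g i :=
  superpolynomialDecay_of_isBigO hf (isBigO_refl κ l) (by simpa using (isBigO_refl f l).mul hg)

theorem superpolynomialDecay_exp_neg_mul (hκ : Tendsto κ l atTop) {c : ℝ} (hc : 0 < c) :
    SuperpolynomialDecay l κ fun i => Real.exp (-c * κ i) := fun n => by
  simpa only [Function.comp_def, Real.rpow_natCast] using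
    (tendsto_rpow_mul_exp_neg_mul_atTop_nhds_zero n c hc).comp hκ

theorem isBigO_inv_pow_of_superpolynomialDecay (hκ : Tendsto κ l atTop)
    (hf : SuperpolynomialDecay l κ f) (K : ℕ) : f =O[l] fun i => (κ i)⁻¹ ^ K := by
  simpa using (superpolynomialDecay_iff_isBigO f hκ).1 hf (-(K : ℤ))

theorem isBigO_one_inv_pow (hκ : Tendsto κ l atTop) (K : ℕ) :
    (fun i => (κ i)⁻¹ ^ K) =O[l] fun _ => (1 : ℝ) := by
  simpa using (hκ.inv_tendsto_atTop.isBigO_one ℝ).pow K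

theorem superpolynomialDecay_sub_sum_of_recurrence {A : ℕ → ι → ℝ} {c : ℕ → ℝ}
    (hκ : Tendsto κ l atTop)
    (hrec : ∀ k, SuperpolynomialDecay l κ fun i => A k i - (1 + c k * (κ i)⁻¹ * A (k + 1) i))
    (K : ℕ) :
    SuperpolynomialDecay l κ fun i =>
      A 0 i - ∑ k ∈ Finset.range K, (∏ j ∈ Finset.range k, c j) * (κ i)⁻¹ ^ k -
        (∏ j ∈ Finset.range K, c j) * (κ i)⁻¹ ^ K * A K i := by
  induction K with
  | zero => exact (superpolynomialDecay_zero l κ).congr fun i => by simp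
  | succ K ih =>
    have hstep := superpolynomialDecay_mul_isBigO_one (hrec K) (isBigO_one_inv_pow hκ K)
    refine (ih.add (hstep.const_mul (∏ j ∈ Finset.range K, c j))).congr fun i => ?_
    simp only [Pi.add_apply, Finset.sum_range_succ, Finset.prod_range_succ]
    ring

theorem isBigO_sub_sum_of_recurrence {A : ℕ → ι → ℝ} {c : ℕ → ℝ} (hκ : Tendsto κ l atTop)
    (hA : ∀ k, A k =O[l] fun _ => (1 : ℝ))
    (hrec : ∀ k, SuperpolynomialDecay l κ fun i => A k i - (1 + c k * (κ i)⁻¹ * A (k + 1) i))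
    (K : ℕ) :
    (fun i => A 0 i - ∑ k ∈ Finset.range K, (∏ j ∈ Finset.range k, c j) * (κ i)⁻¹ ^ k) =O[l]
      fun i => (κ i)⁻¹ ^ K := by
  have hremainder : (fun i => (∏ j ∈ Finset.range K, c j) * (κ i)⁻¹ ^ K * A K i) =O[l]
      fun i => (κ i)⁻¹ ^ K := by
    simpa using ((isBigO_refl (fun i => (κ i)⁻¹ ^ K) l).const_mul_left _).mul (hA K)
  have hsmall := isBigO_inv_pow_of_superpolynomialDecay hκ
    (superpolynomialDecay_sub_sum_of_recurrence hκ hrec K) K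
  exact (hsmall.add hremainder).congr_left fun i => by ring

end Superpolynomial

namespace IsAsymptoticExpansion

variable {ι : Type*} {l : Filter ι} {f g : ι → ℝ} {k₀ k₁ : ℕ} {a b : ℕ → ℝ} {φ : ℕ → ι → ℝ}

theorem congr' (h : IsAsymptoticExpansion l f k₀ a φ) (hfg : f =ᶠ[l] g) :
    IsAsymptoticExpansion l g k₀ a φ :=
  ⟨h.1, fun N hN => (h.2 N hN).congr' (hfg.mono fun z hz => by simp only [hz]) .rfl⟩

theorem sub (hf : IsAsymptoticExpansion l f k₀ a φ) (hg : IsAsymptoticExpansion l g k₀ b φ) :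
    IsAsymptoticExpansion l (fun z => f z - g z) k₀ (fun k => a k - b k) φ := by
  refine ⟨hf.1, fun N hN => ((hf.2 N hN).sub (hg.2 N hN)).congr_left fun z => ?_⟩
  simp only [sub_mul, Finset.sum_sub_distrib]
  ring

theorem of_coeff_eq_zero (h : IsAsymptoticExpansion l f k₀ a φ) (hk : k₀ ≤ k₁)
    (ha : ∀ k < k₁, a k = 0) : IsAsymptoticExpansion l f k₁ a φ := by
  refine ⟨fun k hk' => h.1 k (hk.trans hk'), fun N hN => ?_⟩
  have hsum (z : ι) : ∑ k ∈ Finset.Icc k₁ N, a k * φ k z = ∑ k ∈ Finset.Icc k₀ N, a k * φ k z := by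
    refine Finset.sum_subset (Finset.Icc_subset_Icc_left hk) fun k hkN hk' => ?_
    rw [ha k (by simp only [Finset.mem_Icc] at hkN hk'; omega), zero_mul]
  simpa only [hsum] using h.2 N (hk.trans hN)

theorem isEquivalent (h : IsAsymptoticExpansion l f k₀ a φ) (ha : a k₀ ≠ 0) :
    f ~[l] fun z => a k₀ * φ k₀ z := by
  have := h.2 k₀ le_rfl
  simp only [Finset.Icc_self, Finset.sum_singleton] at this
  exact (isLittleO_const_mul_right_iff ha).2 this

theorem isLittleO_scale (h : IsAsymptoticExpansion l f k₀ a φ) (hk : k₀ < k₁) :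
    φ k₁ =o[l] φ k₀ := by
  induction k₁, hk using Nat.le_induction with
  | base => exact h.1 k₀ le_rfl
  | succ k hk ih => exact (h.1 k (by omega)).trans ih

theorem isLittleO_of_lt (hf : IsAsymptoticExpansion l f k₁ b φ)
    (hg : IsAsymptoticExpansion l g k₀ a φ) (hk : k₀ < k₁) (ha : a k₀ ≠ 0) : f =o[l] g := by
  have hfφ : f =O[l] φ k₁ := by
    have hleading := hf.2 k₁ le_rfl
    simp only [Finset.Icc_self, Finset.sum_singleton] at hleading
    exact (hleading.isBigO.add (isBigO_const_mul_self (b k₁) _ l)).congr_left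
      fun _ => sub_add_cancel _ _
  have hφg : φ k₀ =O[l] g :=
    (isBigO_self_const_mul ha _ l).trans (hg.isEquivalent ha).isBigO_symm
  exact (hfφ.trans_isLittleO (hg.isLittleO_scale hk)).trans_isBigO hφg

end IsAsymptoticExpansion

theorem isAsymptoticExpansion_of_isBigO {ι : Type*} {l : Filter ι} {κ u F : ι → ℝ} {c : ℕ → ℝ}
    (hκ : Tendsto κ l atTop)
    (hF : ∀ K, (fun i => F i - ∑ k ∈ Finset.range K, c k * (κ i)⁻¹ ^ k) =O[l]
      fun i => (κ i)⁻¹ ^ K) :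
    IsAsymptoticExpansion l (fun i => u i * F i) 0 c (fun k i => u i * (1 / κ i ^ k)) := by
  have hscale (k : ℕ) : (fun i => u i * (κ i)⁻¹ ^ (k + 1)) =o[l] fun i => u i * (κ i)⁻¹ ^ k := by
    have hinv : (fun i => (κ i)⁻¹) =o[l] fun _ => (1 : ℝ) :=
      (isLittleO_one_iff ℝ).2 hκ.inv_tendsto_atTop
    simpa [pow_succ, mul_assoc] using
      (isBigO_refl (fun i => u i * (κ i)⁻¹ ^ k) l).mul_isLittleO hinv
  simp only [one_div, ← inv_pow]
  refine ⟨fun k _ => hscale k, fun N _ => IsBigO.trans_isLittleO ?_ (hscale N)⟩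
  refine ((isBigO_refl u l).mul (hF (N + 1))).congr_left fun i => ?_
  simp only [← Nat.range_succ_eq_Icc_zero, mul_sub, Finset.mul_sum, mul_left_comm (u i)]

/-! ### The function `ξ` -/

theorem exp_xi {u : ℝ} (hu : 1 < u) : Real.exp (xi u) = 1 + u * xi u :=
  (xi_spec (by linarith) hu.ne').2

theorem le_xi_of_exp_le {u t : ℝ} (hu : 1 < u) (ht : 0 < t) (h : Real.exp t ≤ 1 + u * t) :
    t ≤ xi u := by
  have h0 := (xi_spec (by linarith) hu.ne').1
  by_contra! hlt
  -- The secant slope of `exp` from `0` to `s` is `u` at `s = ξ(u)` and increases with `s`.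
  have hsecant := strictConvexOn_exp.secant_strict_mono (Set.mem_univ 0) (Set.mem_univ (xi u))
    (Set.mem_univ t) h0 ht.ne' hlt
  simp only [exp_xi hu, Real.exp_zero, add_sub_cancel_left, sub_zero] at hsecant
  rw [mul_div_cancel_right₀ _ h0, lt_div_iff₀ ht] at hsecant
  linarith

theorem log_le_xi {u : ℝ} (hu : 1 < u) : Real.log u ≤ xi u := by
  have hu0 : 0 < u := by linarith
  refine le_xi_of_exp_le hu (Real.log_pos hu) ?_
  have := mul_le_mul_of_nonneg_left (Real.one_sub_inv_le_log_of_pos hu0) hu0.le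
  rw [mul_sub, mul_inv_cancel₀ hu0.ne'] at this
  rw [Real.exp_log hu0]
  linarith

theorem xi_pos {u : ℝ} (hu : 1 < u) : 0 < xi u :=
  (Real.log_pos hu).trans_le (log_le_xi hu)

theorem xi_le_three_mul_log {u : ℝ} (hu : 2 ≤ u) : xi u ≤ 3 * Real.log u := by
  have hu1 : 1 < u := by linarith
  have hξ := xi_pos hu1
  have hquad := Real.quadratic_le_exp_of_nonneg hξ.le
  rw [exp_xi hu1] at hquad
  have hlin : xi u ≤ 2 * u - 2 := by nlinarith
  have hexp : Real.exp (xi u) ≤ u ^ 3 := by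
    rw [exp_xi hu1]
    nlinarith [mul_nonneg (sub_nonneg.2 hu) (sq_nonneg u)]
  have := (Real.le_log_iff_exp_le (by positivity)).2 hexp
  rw [Real.log_pow] at this
  exact_mod_cast this

theorem tendsto_xi_atTop : Tendsto xi atTop atTop :=
  tendsto_atTop_mono' _ ((eventually_gt_atTop 1).mono fun _ => log_le_xi) Real.tendsto_log_atTop

theorem xi_isBigO_log : xi =O[atTop] Real.log := by
  refine IsBigO.of_bound 3 ?_
  filter_upwards [eventually_ge_atTop 2] with u hu
  rw [Real.norm_of_nonneg (xi_pos (by linarith)).le,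
    Real.norm_of_nonneg (Real.log_nonneg (by linarith))]
  exact xi_le_three_mul_log hu

theorem inv_le_two_mul_xi_mul_exp_neg_xi {u : ℝ} (hu : 1 < u) (hξ : 1 ≤ xi u) :
    u⁻¹ ≤ 2 * xi u * Real.exp (-xi u) := by
  rw [Real.exp_neg, ← div_eq_mul_inv, inv_le_iff_one_le_mul₀ (by linarith),
    ← mul_div_right_comm, one_le_div (Real.exp_pos _), exp_xi hu]
  nlinarith

/-! ### Summation by parts -/

theorem inv_ascFactorial_sub_inv_ascFactorial_succ {j : ℕ} (hj : 0 < j) (k : ℕ) :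
    (j.ascFactorial (k + 1) : ℝ)⁻¹ - ((j + 1).ascFactorial (k + 1) : ℝ)⁻¹ =
      (k + 1) * (j.ascFactorial (k + 2) : ℝ)⁻¹ := by
  have hshift : (j : ℝ) * (j + 1).ascFactorial (k + 1) =
      (j + (k + 1)) * j.ascFactorial (k + 1) := by
    exact_mod_cast Nat.succ_ascFactorial j (k + 1)
  have hsucc : (j.ascFactorial (k + 2) : ℝ) = (j + (k + 1)) * j.ascFactorial (k + 1) := by
    exact_mod_cast Nat.ascFactorial_succ (n := j) (k := k + 1)
  have : (0 : ℝ) < j := by exact_mod_cast hj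
  have hA : (0 : ℝ) < j.ascFactorial (k + 1) := by
    exact_mod_cast (Nat.pow_pos hj).trans_le (Nat.pow_succ_le_ascFactorial j (k + 1))
  have : (0 : ℝ) < (j + 1).ascFactorial (k + 1) := by
    exact_mod_cast Nat.ascFactorial_pos j (k + 1)
  rw [hsucc]
  field_simp
  linear_combination hshift

theorem sum_pow_div_ascFactorial {x : ℝ} (hx : x ≠ 1) {J a : ℕ} (hJ : J ≤ a) (k : ℕ) :
    ∑ j ∈ Finset.Ioc J a, x ^ j / j.ascFactorial (k + 1) =
      x / (x - 1) * (x ^ a / (a + 1).ascFactorial (k + 1) -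
        x ^ J / (J + 1).ascFactorial (k + 1) +
        (k + 1) * ∑ j ∈ Finset.Ioc J a, x ^ j / j.ascFactorial (k + 2)) := by
  simp only [div_eq_mul_inv _ (Nat.cast _)]
  have hq : x / (x - 1) * (x - 1) = x := div_mul_cancel₀ _ (sub_ne_zero.2 hx)
  induction a, hJ using Nat.le_induction with
  | base => simp
  | succ a ha ih =>
    have hdiff := inv_ascFactorial_sub_inv_ascFactorial_succ a.succ_pos k
    rw [Nat.succ_eq_add_one] at hdiff
    rw [← Finset.insert_Ioc_right_eq_Ioc_add_one ha, Finset.sum_insert (by simp),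
      Finset.sum_insert (by simp), ih]
    linear_combination x / (x - 1) * x ^ (a + 1) * hdiff -
      x ^ a * ((a + 1).ascFactorial (k + 1) : ℝ)⁻¹ * hq

theorem sum_mul_pow_mul_sub_one (x : ℝ) (a : ℕ) :
    (∑ j ∈ Finset.Icc 1 a, (j : ℝ) * x ^ j) * (x - 1) =
      a * x ^ (a + 1) - ∑ j ∈ Finset.Icc 1 a, x ^ j := by
  induction a with
  | zero => simp
  | succ a ih =>
    rw [Finset.sum_Icc_succ_top (by omega), Finset.sum_Icc_succ_top (by omega), add_mul, ih]
    push_cast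
    ring

theorem sum_pow_mul_sub_one (x : ℝ) (a : ℕ) :
    (∑ j ∈ Finset.Icc 1 a, x ^ j) * (x - 1) = x * (x ^ a - 1) := by
  induction a with
  | zero => simp
  | succ a ih =>
    rw [Finset.sum_Icc_succ_top (by omega), add_mul, ih]
    ring

theorem pow_div_ascFactorial_le_one (a k : ℕ) :
    (a : ℝ) ^ k / (a + 1).ascFactorial k ≤ 1 := by
  have hpos : (0 : ℝ) < (a + 1).ascFactorial k := by exact_mod_cast Nat.ascFactorial_pos a k
  rw [div_le_one hpos]
  exact_mod_cast (Nat.pow_le_pow_left a.le_succ k).trans (Nat.pow_succ_le_ascFactorial _ k)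

theorem one_sub_sq_div_le_pow_div_ascFactorial {a : ℕ} (ha : 0 < a) (k : ℕ) :
    1 - (k : ℝ) ^ 2 / a ≤ (a : ℝ) ^ k / (a + 1).ascFactorial k := by
  have ha' : (0 : ℝ) < a := by exact_mod_cast ha
  have : (0 : ℝ) < (a + 1).ascFactorial k := by exact_mod_cast Nat.ascFactorial_pos a k
  have hle : ((a + 1).ascFactorial k : ℝ) ≤ (a + k) ^ k := by
    exact_mod_cast Nat.ascFactorial_le_pow_add a k
  have hfrac : (k : ℝ) / (a + k) ≤ 1 := (div_le_one (by positivity)).2 (by linarith)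
  calc 1 - (k : ℝ) ^ 2 / a ≤ 1 - (k : ℝ) ^ 2 / (a + k) := by gcongr; linarith
    _ = 1 + k * -((k : ℝ) / (a + k)) := by ring
    _ ≤ (1 + -((k : ℝ) / (a + k))) ^ k := one_add_mul_le_pow (by linarith) k
    _ = (a : ℝ) ^ k / (a + k) ^ k := by rw [← div_pow]; congr 1; field_simp; ring
    _ ≤ (a : ℝ) ^ k / (a + 1).ascFactorial k := by gcongr

theorem pow_div_ascFactorial_le_two_pow {a j : ℕ} (hj : 0 < j) (haj : a ≤ 2 * j) (k : ℕ) :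
    (a : ℝ) ^ k / j.ascFactorial k ≤ 2 ^ k := by
  have hpow : (j : ℝ) ^ k ≤ j.ascFactorial k := by exact_mod_cast Nat.pow_succ_le_ascFactorial j k
  have : (0 : ℝ) < j := by exact_mod_cast hj
  rw [div_le_iff₀ ((by positivity : (0 : ℝ) < j ^ k).trans_le hpow)]
  calc (a : ℝ) ^ k ≤ (2 * j) ^ k := by gcongr; exact_mod_cast haj
    _ = 2 ^ k * (j : ℝ) ^ k := mul_pow _ _ _
    _ ≤ 2 ^ k * j.ascFactorial k := by gcongr

theorem sum_pow_div_le {x : ℝ} (hx : 0 < x) (J : ℕ) :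
    ∑ j ∈ Finset.Icc 1 J, x ^ j / (j : ℝ) ≤ x ^ J + Real.log J := by
  have hharmonic : ∑ j ∈ Finset.Icc 1 J, x ^ j / (j : ℝ) ≤ x ^ J - 1 + harmonic J := by
    induction J with
    | zero => simp
    | succ J ih =>
      have hbernoulli : x ^ (J + 1) - 1 ≤ (J + 1) * (x ^ (J + 1) - x ^ J) := by
        have h := one_add_mul_le_pow (a := x⁻¹ - 1) (by linarith [inv_pos.2 hx]) (J + 1)
        rw [add_sub_cancel, inv_pow, ← mul_le_mul_iff_of_pos_left (pow_pos hx (J + 1)),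
          mul_inv_cancel₀ (by positivity)] at h
        have hxJ : x ^ (J + 1) * x⁻¹ = x ^ J := by rw [pow_succ, mul_inv_cancel_right₀ hx.ne']
        push_cast at h
        linear_combination h - (J + 1) * hxJ
      have hterm : x ^ (J + 1) / ((J + 1 : ℕ) : ℝ) ≤
          x ^ (J + 1) - x ^ J + ((J + 1 : ℕ) : ℝ)⁻¹ := by
        push_cast
        field_simp
        linarith
      rw [Finset.sum_Icc_succ_top (by omega), harmonic_succ]
      push_cast at hterm ⊢
      linarith
  linarith [harmonic_le_one_add_log J]

/-! ### The saddle point equation -/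

/-- `x` is the saddle point `x_{n,α}(1)` for `a = α(n)` and `u = n / α(n)`, in the regime `1 < x`
of short cycles. -/
structure IsSaddle (a : ℕ) (x u : ℝ) : Prop where
  length_pos : 0 < a
  one_lt : 1 < x
  sum_pow : ∑ j ∈ Finset.Icc 1 a, x ^ j = a * u

/-- The distance of `x⁻¹` from `1` in units of `1 / a`. For a saddle point it is the exact
counterpart of `ξ(u)`: `x ^ a = 1 + u * scaledGap a x`, to be compared with `e ^ ξ = 1 + u * ξ`. -/
noncomputable def scaledGap (a : ℕ) (x : ℝ) : ℝ :=
  a * (1 - x⁻¹)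

/-- The upper half of `∑ x ^ j / (j * (j + 1) * ⋯ * (j + k))`, which for `k = 0` carries the
whole asymptotics of `∑ x ^ j / j`. The factor `a ^ k / u` makes it tend to `1`; the lower half is
left out because `1 / (j * (j + 1) * ⋯ * (j + k))` is comparable to `a ^ (-k - 1)` only for `j` of
order `a`. -/
noncomputable def tailSum (a : ℕ) (x u : ℝ) (k : ℕ) : ℝ :=
  a ^ k / u * ∑ j ∈ Finset.Ioc (a / 2) a, x ^ j / j.ascFactorial (k + 1)

/-- The ratio of `a` to the mean of `j` under the weights `x ^ j` on `1 ≤ j ≤ a`. The derivative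
term of the variance is a multiple of it. -/
noncomputable def lengthRatio (a : ℕ) (x : ℝ) : ℝ :=
  a * (∑ j ∈ Finset.Icc 1 a, x ^ j) / ∑ j ∈ Finset.Icc 1 a, (j : ℝ) * x ^ j

namespace IsSaddle

variable {a : ℕ} {x u : ℝ}

theorem length_pos' (h : IsSaddle a x u) : (0 : ℝ) < a :=
  Nat.cast_pos.2 h.length_pos

theorem pos (h : IsSaddle a x u) : 0 < x :=
  one_pos.trans h.one_lt

theorem one_lt_ratio (h : IsSaddle a x u) : 1 < u := by
  have := sum_pow_lt h.length_pos one_pos h.one_lt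
  simp only [one_pow, Finset.sum_const, Nat.card_Icc, add_tsub_cancel_right, nsmul_eq_mul,
    h.sum_pow] at this
  exact lt_of_mul_lt_mul_left this h.length_pos'.le

theorem ratio_le_pow (h : IsSaddle a x u) : u ≤ x ^ a := by
  refine le_of_mul_le_mul_left ?_ h.length_pos'
  rw [← h.sum_pow, ← nsmul_eq_mul]
  simpa using Finset.sum_le_card_nsmul (Finset.Icc 1 a) (fun j => x ^ j) (x ^ a)
    fun j hj => pow_le_pow_right₀ h.one_lt.le (Finset.mem_Icc.1 hj).2

theorem scaledGap_pos (h : IsSaddle a x u) : 0 < scaledGap a x :=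
  mul_pos h.length_pos' (sub_pos.2 (inv_lt_one_of_one_lt₀ h.one_lt))

theorem div_sub_one_eq (h : IsSaddle a x u) : x / (x - 1) = a * (scaledGap a x)⁻¹ := by
  have := h.length_pos'
  have := h.pos
  have := sub_pos.2 h.one_lt
  have hgap : scaledGap a x = a * ((x - 1) / x) := by rw [scaledGap]; field_simp
  rw [hgap]
  field_simp

theorem pow_eq (h : IsSaddle a x u) : x ^ a = 1 + u * scaledGap a x := by
  have := h.pos
  have hgeom := sum_pow_mul_sub_one x a
  rw [h.sum_pow] at hgeom
  rw [scaledGap]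
  field_simp
  linear_combination -hgeom

theorem scaledGap_le_mul_log (h : IsSaddle a x u) : scaledGap a x ≤ a * Real.log x :=
  mul_le_mul_of_nonneg_left (Real.one_sub_inv_le_log_of_pos h.pos) h.length_pos'.le

theorem mul_log_sub_scaledGap_le (h : IsSaddle a x u) :
    a * Real.log x - scaledGap a x ≤ (a * Real.log x) ^ 2 / a := by
  have := h.length_pos'
  have hL := Real.log_pos h.one_lt
  have hinv : x⁻¹ ≤ (1 + Real.log x)⁻¹ := by
    gcongr
    linarith [Real.log_le_sub_one_of_pos h.pos]
  have hquad : (1 + Real.log x)⁻¹ ≤ 1 - Real.log x + Real.log x ^ 2 := by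
    rw [inv_le_iff_one_le_mul₀ (by positivity)]
    nlinarith [pow_pos hL 3]
  calc a * Real.log x - scaledGap a x = a * (Real.log x - 1 + x⁻¹) := by rw [scaledGap]; ring
    _ ≤ a * Real.log x ^ 2 := by gcongr; linarith
    _ = (a * Real.log x) ^ 2 / a := by field_simp

theorem log_ratio_le_mul_log (h : IsSaddle a x u) : Real.log u ≤ a * Real.log x := by
  rw [← Real.log_pow]
  exact Real.log_le_log (one_pos.trans h.one_lt_ratio) h.ratio_le_pow

theorem exp_mul_log (h : IsSaddle a x u) :
    Real.exp (a * Real.log x) = 1 + u * scaledGap a x := by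
  rw [← Real.log_pow, Real.exp_log (pow_pos h.pos a), h.pow_eq]

theorem mul_log_le_xi (h : IsSaddle a x u) : a * Real.log x ≤ xi u := by
  have hu := h.one_lt_ratio
  refine le_xi_of_exp_le hu (mul_pos h.length_pos' (Real.log_pos h.one_lt)) ?_
  rw [h.exp_mul_log]
  gcongr
  exact h.scaledGap_le_mul_log

theorem scaledGap_le_xi (h : IsSaddle a x u) : scaledGap a x ≤ xi u :=
  h.scaledGap_le_mul_log.trans h.mul_log_le_xi

theorem mul_log_sub_scaledGap_le_xi (h : IsSaddle a x u) :
    a * Real.log x - scaledGap a x ≤ xi u ^ 2 / a :=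
  h.mul_log_sub_scaledGap_le.trans <| by
    have := mul_nonneg h.length_pos'.le (Real.log_nonneg h.one_lt.le)
    gcongr
    exact h.mul_log_le_xi

theorem xi_sub_scaledGap_le (h : IsSaddle a x u) (hgap : 2 ≤ scaledGap a x) :
    xi u - scaledGap a x ≤ 2 * (xi u ^ 2 / a) := by
  have hu := h.one_lt_ratio
  have hle := h.scaledGap_le_xi
  -- Divide `e ^ ξ = 1 + u * ξ` by `x ^ a = 1 + u * scaledGap a x`.
  have hquot : xi u - a * Real.log x + 1 ≤ (1 + u * xi u) / (1 + u * scaledGap a x) := by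
    rw [← exp_xi hu, ← h.exp_mul_log, ← Real.exp_sub]
    exact Real.add_one_le_exp _
  have hhalf : (1 + u * xi u) / (1 + u * scaledGap a x) ≤ 1 + (xi u - scaledGap a x) / 2 := by
    rw [div_le_iff₀ (by positivity)]
    nlinarith [mul_nonneg (sub_nonneg.2 hle) (mul_nonneg (by linarith : 0 ≤ u) (sub_nonneg.2 hgap))]
  linarith [h.mul_log_sub_scaledGap_le_xi]

theorem abs_inv_scaledGap_sub_inv_xi_le (h : IsSaddle a x u) (hgap : 2 ≤ scaledGap a x) :
    |(scaledGap a x)⁻¹ - (xi u)⁻¹| ≤ xi u / a := by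
  have := h.length_pos'
  have hσ := h.scaledGap_pos
  have hξ := xi_pos h.one_lt_ratio
  have hle := h.scaledGap_le_xi
  rw [abs_of_nonneg (sub_nonneg.2 (by gcongr)), inv_sub_inv hσ.ne' hξ.ne',
    div_le_iff₀ (by positivity)]
  calc xi u - scaledGap a x ≤ 2 * (xi u ^ 2 / a) := h.xi_sub_scaledGap_le hgap
    _ = xi u / a * (2 * xi u) := by ring
    _ ≤ xi u / a * (scaledGap a x * xi u) := by gcongr

theorem pow_half_le (h : IsSaddle a x u) : x ^ (a / 2) ≤ Real.exp (xi u / 2) := by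
  have hdiv : ((a / 2 : ℕ) : ℝ) ≤ a / 2 := Nat.cast_div_le
  rw [← Real.log_le_iff_le_exp (pow_pos h.pos _), Real.log_pow]
  calc ((a / 2 : ℕ) : ℝ) * Real.log x ≤ a / 2 * Real.log x := by
        have := Real.log_pos h.one_lt
        gcongr
    _ ≤ xi u / 2 := by linarith [h.mul_log_le_xi]

theorem sum_mul_pow_eq (h : IsSaddle a x u) :
    ∑ j ∈ Finset.Icc 1 a, (j : ℝ) * x ^ j =
      a ^ 2 * u * (1 - (scaledGap a x)⁻¹ + 1 / a + (scaledGap a x)⁻¹ / u) := by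
  have := h.length_pos'
  have := one_pos.trans h.one_lt_ratio
  have hσ : scaledGap a x * (scaledGap a x)⁻¹ = 1 := mul_inv_cancel₀ h.scaledGap_pos.ne'
  have hx : x - 1 ≠ 0 := sub_ne_zero.2 h.one_lt.ne'
  have hsum := sum_mul_pow_mul_sub_one x a
  rw [h.sum_pow, pow_succ, h.pow_eq, ← eq_div_iff hx] at hsum
  calc _ = a * (1 + u * scaledGap a x) * (x / (x - 1)) - a * u * (x / (x - 1) - 1) := by
        rw [hsum]
        field_simp
        ring
    _ = _ := by
        rw [h.div_sub_one_eq]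
        field_simp
        linear_combination a * u * hσ

theorem tailSum_nonneg (h : IsSaddle a x u) (k : ℕ) : 0 ≤ tailSum a x u k := by
  have := h.pos
  have := one_pos.trans h.one_lt_ratio
  rw [tailSum]
  positivity

theorem tailSum_le (h : IsSaddle a x u) (k : ℕ) : tailSum a x u k ≤ 2 ^ (k + 1) := by
  have := h.length_pos'
  have := h.pos
  have := one_pos.trans h.one_lt_ratio
  have hterm : ∀ j ∈ Finset.Ioc (a / 2) a,
      a ^ (k + 1) * (x ^ j / j.ascFactorial (k + 1)) ≤ 2 ^ (k + 1) * x ^ j := fun j hj => by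
    rw [Finset.mem_Ioc] at hj
    have := pow_div_ascFactorial_le_two_pow (a := a) (j := j) (by omega) (by omega) (k + 1)
    calc _ = (a : ℝ) ^ (k + 1) / j.ascFactorial (k + 1) * x ^ j := by ring
      _ ≤ _ := by gcongr
  have hsubset : Finset.Ioc (a / 2) a ⊆ Finset.Icc 1 a := fun j hj => by
    simp only [Finset.mem_Ioc, Finset.mem_Icc] at hj ⊢
    omega
  calc tailSum a x u k
      = (∑ j ∈ Finset.Ioc (a / 2) a, a ^ (k + 1) * (x ^ j / j.ascFactorial (k + 1))) / (a * u) := by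
        rw [tailSum, ← Finset.mul_sum]
        field_simp
        ring
    _ ≤ (∑ j ∈ Finset.Ioc (a / 2) a, 2 ^ (k + 1) * x ^ j) / (a * u) :=
        div_le_div_of_nonneg_right (Finset.sum_le_sum hterm) (by positivity)
    _ ≤ (∑ j ∈ Finset.Icc 1 a, 2 ^ (k + 1) * x ^ j) / (a * u) := by gcongr
    _ = 2 ^ (k + 1) := by
        rw [← Finset.mul_sum, h.sum_pow]
        field_simp

theorem tailSum_eq (h : IsSaddle a x u) (k : ℕ) :
    tailSum a x u k =
      (1 + (scaledGap a x)⁻¹ / u) * (a ^ (k + 1) / (a + 1).ascFactorial (k + 1)) -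
        (scaledGap a x)⁻¹ * (x ^ (a / 2) / u) *
          (a ^ (k + 1) / (a / 2 + 1).ascFactorial (k + 1)) +
        (k + 1) * (scaledGap a x)⁻¹ * tailSum a x u (k + 1) := by
  have := one_pos.trans h.one_lt_ratio
  have := h.scaledGap_pos
  have hpow : 1 + (scaledGap a x)⁻¹ / u = (scaledGap a x)⁻¹ * x ^ a / u := by
    rw [h.pow_eq]
    field_simp
    ring
  rw [hpow, tailSum, sum_pow_div_ascFactorial h.one_lt.ne' (Nat.div_le_self a 2),
    h.div_sub_one_eq, tailSum]
  ring

theorem abs_tailSum_sub_le (h : IsSaddle a x u) (hgap : 1 ≤ scaledGap a x) (k : ℕ) :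
    |tailSum a x u k - (1 + (k + 1) * (scaledGap a x)⁻¹ * tailSum a x u (k + 1))| ≤
      (k + 1) ^ 2 / a + 2 ^ (k + 1) * (x ^ (a / 2) / u) := by
  have hu := one_pos.trans h.one_lt_ratio
  have hx := h.pos
  have hupper := pow_div_ascFactorial_le_one a (k + 1)
  have hlower := one_sub_sq_div_le_pow_div_ascFactorial h.length_pos (k + 1)
  have hhalf := pow_div_ascFactorial_le_two_pow (a := a) (j := a / 2 + 1) (by omega) (by omega)
    (k + 1)
  have : 0 ≤ (scaledGap a x)⁻¹ := by positivity
  have hp1 : (scaledGap a x)⁻¹ ≤ 1 := inv_le_one_of_one_le₀ hgap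
  have hpow : 1 ≤ x ^ (a / 2) := one_le_pow₀ h.one_lt.le
  set E : ℝ := a ^ (k + 1) / (a + 1).ascFactorial (k + 1)
  set F : ℝ := a ^ (k + 1) / (a / 2 + 1).ascFactorial (k + 1)
  have : 0 ≤ E := by positivity
  have : 0 ≤ F := by positivity
  have htop : (scaledGap a x)⁻¹ / u * E ≤ x ^ (a / 2) / u :=
    (mul_le_of_le_one_right (by positivity) hupper).trans (by gcongr; linarith)
  have hbot : (scaledGap a x)⁻¹ * (x ^ (a / 2) / u) * F ≤ 2 ^ (k + 1) * (x ^ (a / 2) / u) := by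
    calc _ ≤ 1 * (x ^ (a / 2) / u) * 2 ^ (k + 1) := by gcongr
      _ = _ := by ring
  have hone : x ^ (a / 2) / u ≤ 2 ^ (k + 1) * (x ^ (a / 2) / u) :=
    le_mul_of_one_le_left (by positivity) (one_le_pow₀ one_le_two)
  have hbot0 : 0 ≤ (scaledGap a x)⁻¹ * (x ^ (a / 2) / u) * F := by positivity
  have htop0 : 0 ≤ (scaledGap a x)⁻¹ / u * E := by positivity
  have hsq : 0 ≤ ((k : ℝ) + 1) ^ 2 / a := by positivity
  push_cast at hlower
  rw [h.tailSum_eq k, abs_le]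
  constructor <;> linarith

theorem abs_sum_pow_div_sub_tailSum_le (h : IsSaddle a x u) :
    |(∑ j ∈ Finset.Icc 1 a, x ^ j / (j : ℝ)) / u - tailSum a x u 0| ≤
      x ^ (a / 2) / u + Real.log a / u := by
  have hu := one_pos.trans h.one_lt_ratio
  have hx := h.pos
  have hsplit : ∑ j ∈ Finset.Icc 1 a, x ^ j / (j : ℝ) =
      ∑ j ∈ Finset.Icc 1 (a / 2), x ^ j / (j : ℝ) + ∑ j ∈ Finset.Ioc (a / 2) a, x ^ j / (j : ℝ) :=
    (Finset.sum_Ioc_consecutive _ (Nat.zero_le _) (Nat.div_le_self a 2)).symm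
  have hhead : (∑ j ∈ Finset.Icc 1 a, x ^ j / (j : ℝ)) / u - tailSum a x u 0 =
      (∑ j ∈ Finset.Icc 1 (a / 2), x ^ j / (j : ℝ)) / u := by
    rw [hsplit, tailSum]
    simp only [zero_add, pow_zero, Nat.ascFactorial_succ, Nat.ascFactorial_zero,
      add_zero, mul_one]
    ring
  have hlog : Real.log (a / 2 : ℕ) ≤ Real.log a := by
    rcases (a / 2).eq_zero_or_pos with hzero | hpos
    · simpa [hzero] using Real.log_natCast_nonneg a
    · gcongr
      exact Nat.div_le_self a 2
  rw [hhead, abs_of_nonneg (by positivity), ← add_div]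
  gcongr
  linarith [sum_pow_div_le hx (a / 2)]

theorem sum_mul_pow_pos (h : IsSaddle a x u) : 0 < ∑ j ∈ Finset.Icc 1 a, (j : ℝ) * x ^ j :=
  Finset.sum_pos (fun j hj => mul_pos (Nat.cast_pos.2 (Finset.mem_Icc.1 hj).1) (pow_pos h.pos j))
    ⟨1, Finset.left_mem_Icc.2 h.length_pos⟩

theorem lengthRatio_mul_eq_one (h : IsSaddle a x u) :
    lengthRatio a x * (1 - (scaledGap a x)⁻¹ + 1 / a + (scaledGap a x)⁻¹ / u) = 1 := by
  have := h.length_pos'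
  have := one_pos.trans h.one_lt_ratio
  rw [lengthRatio, h.sum_pow, div_mul_eq_mul_div, div_eq_one_iff_eq h.sum_mul_pow_pos.ne',
    h.sum_mul_pow_eq]
  ring

theorem abs_lengthRatio_le_two (h : IsSaddle a x u) (hgap : 2 ≤ scaledGap a x) :
    |lengthRatio a x| ≤ 2 := by
  have := h.length_pos'
  have := h.scaledGap_pos
  have := one_pos.trans h.one_lt_ratio
  have hinv : (scaledGap a x)⁻¹ ≤ 2⁻¹ := by gcongr
  have herror : 0 ≤ 1 / (a : ℝ) + (scaledGap a x)⁻¹ / u := by positivity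
  have hle : 2⁻¹ ≤ 1 - (scaledGap a x)⁻¹ + 1 / a + (scaledGap a x)⁻¹ / u := by linarith
  rw [eq_inv_of_mul_eq_one_left h.lengthRatio_mul_eq_one, abs_of_pos (inv_pos.2 (by linarith))]
  exact inv_le_of_inv_le₀ two_pos hle

end IsSaddle

/-! ### Superpolynomially small errors -/

/-- A family of saddle points whose ratios `u = n / a` tend to infinity, while `a` is so large that
`1 / a`, and so small that `log a / u`, are negligible against all powers of `log u`, hence of
`1 / ξ(u)`. -/
structure SaddleRegime {ι : Type*} (l : Filter ι) (a : ι → ℕ) (x u : ι → ℝ) : Prop where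
  isSaddle : ∀ᶠ i in l, IsSaddle (a i) (x i) (u i)
  tendsto_ratio : Tendsto u l atTop
  inv_length : SuperpolynomialDecay l (fun i => Real.log (u i)) fun i => (a i : ℝ)⁻¹
  log_length_div : SuperpolynomialDecay l (fun i => Real.log (u i)) fun i => Real.log (a i) / u i

namespace SaddleRegime

variable {ι : Type*} {l : Filter ι} {a : ι → ℕ} {x u : ι → ℝ}

theorem tendsto_xi (h : SaddleRegime l a x u) : Tendsto (fun i => xi (u i)) l atTop :=
  tendsto_xi_atTop.comp h.tendsto_ratio

theorem superpolynomialDecay_xi_of_log (h : SaddleRegime l a x u) {f : ι → ℝ}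
    (hf : SuperpolynomialDecay l (fun i => Real.log (u i)) f) :
    SuperpolynomialDecay l (fun i => xi (u i)) f :=
  superpolynomialDecay_of_isBigO hf (xi_isBigO_log.comp_tendsto h.tendsto_ratio)
    (isBigO_refl f l)

theorem eventually_two_le_scaledGap (h : SaddleRegime l a x u) :
    ∀ᶠ i in l, 2 ≤ scaledGap (a i) (x i) := by
  have hsmall : ∀ᶠ i in l, xi (u i) ^ 2 * (a i : ℝ)⁻¹ < 1 :=
    (h.superpolynomialDecay_xi_of_log h.inv_length 2).eventually_lt_const one_pos
  have hlog : ∀ᶠ i in l, 3 ≤ Real.log (u i) :=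
    (Real.tendsto_log_atTop.comp h.tendsto_ratio).eventually_ge_atTop 3
  filter_upwards [h.isSaddle, hsmall, hlog] with i hi hsmall hlog
  rw [← div_eq_mul_inv] at hsmall
  linarith [hi.mul_log_sub_scaledGap_le_xi, hi.log_ratio_le_mul_log]

theorem superpolynomialDecay_inv_scaledGap_sub (h : SaddleRegime l a x u) :
    SuperpolynomialDecay l (fun i => xi (u i))
      fun i => (scaledGap (a i) (x i))⁻¹ - (xi (u i))⁻¹ := by
  refine superpolynomialDecay_of_isBigO (h.superpolynomialDecay_xi_of_log h.inv_length).param_mul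
    (isBigO_refl _ l) (IsBigO.of_norm_eventuallyLE ?_)
  filter_upwards [h.isSaddle, h.eventually_two_le_scaledGap] with i hi hgap
  exact hi.abs_inv_scaledGap_sub_inv_xi_le hgap

theorem superpolynomialDecay_pow_half_div (h : SaddleRegime l a x u) :
    SuperpolynomialDecay l (fun i => xi (u i)) fun i => x i ^ (a i / 2) / u i := by
  have hexp := (superpolynomialDecay_exp_neg_mul h.tendsto_xi one_half_pos).param_mul.const_mul 2
  refine superpolynomialDecay_of_isBigO hexp (isBigO_refl _ l) (IsBigO.of_norm_eventuallyLE ?_)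
  filter_upwards [h.isSaddle, h.tendsto_xi.eventually_ge_atTop 1] with i hi hξ
  have := hi.pos
  have := one_pos.trans hi.one_lt_ratio
  rw [Real.norm_of_nonneg (by positivity), div_eq_mul_inv]
  calc x i ^ (a i / 2) * (u i)⁻¹
      ≤ Real.exp (xi (u i) / 2) * (2 * xi (u i) * Real.exp (-xi (u i))) := by
        gcongr
        · exact hi.pow_half_le
        · exact inv_le_two_mul_xi_mul_exp_neg_xi hi.one_lt_ratio hξ
    _ = 2 * (xi (u i) * (Real.exp (xi (u i) / 2) * Real.exp (-xi (u i)))) := by ring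
    _ = 2 * (xi (u i) * Real.exp (-(1 / 2) * xi (u i))) := by
        rw [← Real.exp_add]
        congr 3
        ring

theorem superpolynomialDecay_inv_ratio (h : SaddleRegime l a x u) :
    SuperpolynomialDecay l (fun i => xi (u i)) fun i => (u i)⁻¹ := by
  refine superpolynomialDecay_of_isBigO h.superpolynomialDecay_pow_half_div (isBigO_refl _ l)
    (IsBigO.of_norm_eventuallyLE ?_)
  filter_upwards [h.isSaddle] with i hi
  have := one_pos.trans hi.one_lt_ratio
  rw [Real.norm_of_nonneg (by positivity), ← one_div]
  gcongr
  exact one_le_pow₀ hi.one_lt.le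

theorem isBigO_tailSum (h : SaddleRegime l a x u) (k : ℕ) :
    (fun i => tailSum (a i) (x i) (u i) k) =O[l] fun _ => (1 : ℝ) := by
  refine IsBigO.of_bound (2 ^ (k + 1)) ?_
  filter_upwards [h.isSaddle] with i hi
  rw [Real.norm_of_nonneg (hi.tailSum_nonneg k), norm_one, mul_one]
  exact hi.tailSum_le k

theorem superpolynomialDecay_tailSum_sub (h : SaddleRegime l a x u) (k : ℕ) :
    SuperpolynomialDecay l (fun i => xi (u i)) fun i =>
      tailSum (a i) (x i) (u i) k -
        (1 + (k + 1 : ℕ) * (xi (u i))⁻¹ * tailSum (a i) (x i) (u i) (k + 1)) := by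
  have hbound := ((h.superpolynomialDecay_xi_of_log h.inv_length).const_mul (((k : ℝ) + 1) ^ 2)).add
    (h.superpolynomialDecay_pow_half_div.const_mul (2 ^ (k + 1)))
  have hexact : SuperpolynomialDecay l (fun i => xi (u i)) fun i =>
      tailSum (a i) (x i) (u i) k -
        (1 + (k + 1) * (scaledGap (a i) (x i))⁻¹ * tailSum (a i) (x i) (u i) (k + 1)) := by
    refine superpolynomialDecay_of_isBigO hbound (isBigO_refl _ l)
      (IsBigO.of_norm_eventuallyLE ?_)
    filter_upwards [h.isSaddle, h.eventually_two_le_scaledGap] with i hi hgap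
    exact hi.abs_tailSum_sub_le (by linarith) k
  have hreplace := superpolynomialDecay_mul_isBigO_one h.superpolynomialDecay_inv_scaledGap_sub
    (h.isBigO_tailSum (k + 1))
  refine (hexact.add (hreplace.const_mul ((k : ℝ) + 1))).congr fun i => ?_
  simp only [Pi.add_apply, Nat.cast_add, Nat.cast_one]
  ring

theorem superpolynomialDecay_sum_pow_div_sub_tailSum (h : SaddleRegime l a x u) :
    SuperpolynomialDecay l (fun i => xi (u i)) fun i =>
      (∑ j ∈ Finset.Icc 1 (a i), x i ^ j / (j : ℝ)) / u i - tailSum (a i) (x i) (u i) 0 := by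
  refine superpolynomialDecay_of_isBigO
    (h.superpolynomialDecay_pow_half_div.add (h.superpolynomialDecay_xi_of_log h.log_length_div))
    (isBigO_refl _ l) (IsBigO.of_norm_eventuallyLE ?_)
  filter_upwards [h.isSaddle] with i hi
  exact hi.abs_sum_pow_div_sub_tailSum_le

theorem isAsymptoticExpansion_sum_pow_div (h : SaddleRegime l a x u) :
    IsAsymptoticExpansion l (fun i => ∑ j ∈ Finset.Icc 1 (a i), x i ^ j / (j : ℝ)) 0
      (fun k => (k.factorial : ℝ)) (fun k i => u i * (1 / xi (u i) ^ k)) := by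
  have htail := isBigO_sub_sum_of_recurrence h.tendsto_xi h.isBigO_tailSum
    h.superpolynomialDecay_tailSum_sub
  have hsum (K : ℕ) := (isBigO_inv_pow_of_superpolynomialDecay h.tendsto_xi
    h.superpolynomialDecay_sum_pow_div_sub_tailSum K).add (htail K)
  simp only [← Nat.cast_prod, Finset.prod_range_add_one_eq_factorial, sub_add_sub_cancel] at hsum
  refine (isAsymptoticExpansion_of_isBigO (u := u) h.tendsto_xi hsum).congr' ?_
  filter_upwards [h.tendsto_ratio.eventually_ne_atTop 0] with i hi
  exact mul_div_cancel₀ _ hi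

theorem isBigO_lengthRatio (h : SaddleRegime l a x u) :
    (fun i => lengthRatio (a i) (x i)) =O[l] fun _ => (1 : ℝ) := by
  refine IsBigO.of_bound 2 ?_
  filter_upwards [h.isSaddle, h.eventually_two_le_scaledGap] with i hi hgap
  simpa using hi.abs_lengthRatio_le_two hgap

theorem isBigO_inv_scaledGap (h : SaddleRegime l a x u) :
    (fun i => (scaledGap (a i) (x i))⁻¹) =O[l] fun _ => (1 : ℝ) := by
  refine IsBigO.of_bound 1 (h.eventually_two_le_scaledGap.mono fun i hi => ?_)
  rw [Real.norm_of_nonneg (inv_nonneg.2 (by linarith)), norm_one, mul_one]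
  exact inv_le_one_of_one_le₀ (by linarith)

theorem superpolynomialDecay_lengthRatio_sub (h : SaddleRegime l a x u) :
    SuperpolynomialDecay l (fun i => xi (u i)) fun i =>
      lengthRatio (a i) (x i) - (1 + 1 * (xi (u i))⁻¹ * lengthRatio (a i) (x i)) := by
  have herror := (h.superpolynomialDecay_xi_of_log h.inv_length).add
    (superpolynomialDecay_mul_isBigO_one h.superpolynomialDecay_inv_ratio h.isBigO_inv_scaledGap)
  have hsmall := h.superpolynomialDecay_inv_scaledGap_sub.add (herror.const_mul (-1))
  refine (superpolynomialDecay_mul_isBigO_one hsmall h.isBigO_lengthRatio).congr' ?_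
  filter_upwards [h.isSaddle] with i hi
  simp only [Pi.add_apply]
  linear_combination -hi.lengthRatio_mul_eq_one

theorem isAsymptoticExpansion_mul_lengthRatio (h : SaddleRegime l a x u) :
    IsAsymptoticExpansion l (fun i => u i * lengthRatio (a i) (x i)) 0 (fun _ => 1)
      (fun k i => u i * (1 / xi (u i) ^ k)) := by
  refine isAsymptoticExpansion_of_isBigO h.tendsto_xi fun K => ?_
  simpa only [Finset.prod_const_one] using isBigO_sub_sum_of_recurrence
    (c := fun _ => 1) h.tendsto_xi (fun _ => h.isBigO_lengthRatio)
    (fun _ => h.superpolynomialDecay_lengthRatio_sub) K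

end SaddleRegime

/-! ### Cycle counts -/

section CycleCounts

variable {α : ℕ → ℕ} {n : ℕ}

theorem pos_and_lt_of_one_lt_div {a : ℕ} (h : 1 < (n : ℝ) / a) : 0 < a ∧ a < n := by
  rcases a.eq_zero_or_pos with rfl | ha
  · norm_num at h
  · exact ⟨ha, by exact_mod_cast (one_lt_div (Nat.cast_pos.2 ha)).1 h⟩

theorem isSaddle_saddle (hn : 1 < (n : ℝ) / α n) : IsSaddle (α n) (saddle α n 1) (n / α n) := by
  obtain ⟨hα, hlt⟩ := pos_and_lt_of_one_lt_div hn
  obtain ⟨hpos, hsum⟩ := saddle_spec (hα.trans hlt) hα one_pos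
  rw [div_one] at hsum
  refine ⟨hα, ?_, by rw [hsum, mul_div_cancel₀ _ (Nat.cast_pos.2 hα).ne']⟩
  by_contra! hle
  have hsum_le := Finset.sum_le_card_nsmul (Finset.Icc 1 (α n)) (fun j => saddle α n 1 ^ j) 1
    fun j _ => pow_le_one₀ hpos.le hle
  rw [hsum, Nat.card_Icc, add_tsub_cancel_right, nsmul_one] at hsum_le
  exact hlt.not_ge (by exact_mod_cast hsum_le)

theorem deriv_saddle_mul_sum (hn : 1 ≤ n) (hα : 1 ≤ α n) {w : ℝ} (hw : 0 < w) :
    deriv (saddle α n) w * ∑ j ∈ Finset.Icc 1 (α n), (j : ℝ) * saddle α n w ^ j =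
      -(n / w ^ 2) * saddle α n w := by
  have hsaddle := (saddle_differentiableAt hn hα hw).hasDerivAt
  have hsum : HasDerivAt (fun t => ∑ j ∈ Finset.Icc 1 (α n), saddle α n t ^ j)
      (∑ j ∈ Finset.Icc 1 (α n), j * saddle α n w ^ (j - 1) * deriv (saddle α n) w) w :=
    HasDerivAt.fun_sum fun j _ => hsaddle.fun_pow j
  have hdiv : HasDerivAt (fun t => ∑ j ∈ Finset.Icc 1 (α n), saddle α n t ^ j)
      (n * -(w ^ 2)⁻¹) w :=
    ((hasDerivAt_inv hw.ne').const_mul (n : ℝ)).congr_of_eventuallyEq <| by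
      filter_upwards [lt_mem_nhds hw] with t ht
      rw [(saddle_spec hn hα ht).2, div_eq_mul_inv]
  calc _ = (∑ j ∈ Finset.Icc 1 (α n), j * saddle α n w ^ (j - 1) * deriv (saddle α n) w) *
        saddle α n w := by
        rw [Finset.mul_sum, Finset.sum_mul]
        refine Finset.sum_congr rfl fun j hj => ?_
        rw [← pow_sub_one_mul (Nat.one_le_iff_ne_zero.1 (Finset.mem_Icc.1 hj).1)]
        ring
    _ = _ := by
        rw [hsum.unique hdiv]
        ring

theorem var_eq_mean_sub (hn : 1 < (n : ℝ) / α n) :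
    var α n = mean α n - n / α n * lengthRatio (α n) (saddle α n 1) := by
  have h := isSaddle_saddle hn
  have := h.length_pos'
  have hderiv := deriv_saddle_mul_sum (h.length_pos.trans (pos_and_lt_of_one_lt_div hn).2)
    h.length_pos one_pos
  rw [← eq_div_iff h.sum_mul_pow_pos.ne'] at hderiv
  have := h.sum_mul_pow_pos
  have := h.pos
  rw [var, hderiv, lengthRatio, h.sum_pow]
  field_simp
  ring

theorem saddleRegime_saddle (hratio : Tendsto (fun n : ℕ => (n : ℝ) / α n) atTop atTop)
    (hinv : SuperpolynomialDecay atTop (fun n : ℕ => Real.log (n / α n)) fun n => (α n : ℝ)⁻¹)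
    (hlog : SuperpolynomialDecay atTop (fun n : ℕ => Real.log (n / α n))
      fun n => Real.log (α n) / (n / α n)) :
    SaddleRegime atTop α (fun n => saddle α n 1) fun n => n / α n where
  isSaddle := (hratio.eventually_gt_atTop 1).mono fun _ => isSaddle_saddle
  tendsto_ratio := hratio
  inv_length := hinv
  log_length_div := hlog

end CycleCounts

namespace SaddleRegime

variable {α : ℕ → ℕ}

theorem isAsymptoticExpansion_var
    (h : SaddleRegime atTop α (fun n => saddle α n 1) fun n => n / α n) :
    IsAsymptoticExpansion atTop (var α) 2 (fun k => (k.factorial : ℝ) - 1)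
      (fun k n => (n : ℝ) / α n * (1 / xi (n / α n) ^ k)) := by
  have hdiff := h.isAsymptoticExpansion_sum_pow_div.sub h.isAsymptoticExpansion_mul_lengthRatio
  refine (hdiff.congr' ?_).of_coeff_eq_zero (Nat.zero_le 2) fun k hk => ?_
  · filter_upwards [h.tendsto_ratio.eventually_gt_atTop 1] with n hn
    exact (var_eq_mean_sub hn).symm
  · interval_cases k <;> simp

end SaddleRegime

section PowerBounds

variable {α : ℕ → ℕ} {c₀ c₁ c : ℝ}

theorem superpolynomialDecay_natCast_rpow_neg (hc : 0 < c) :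
    SuperpolynomialDecay atTop (fun n : ℕ => Real.log n) fun n => (n : ℝ) ^ (-c) := by
  have hlog : Tendsto (fun n : ℕ => Real.log n) atTop atTop :=
    Real.tendsto_log_atTop.comp tendsto_natCast_atTop_atTop
  refine (superpolynomialDecay_exp_neg_mul hlog hc).congr' ?_
  filter_upwards [eventually_gt_atTop 0] with n hn
  rw [Real.rpow_def_of_pos (Nat.cast_pos.2 hn), mul_comm]

theorem superpolynomialDecay_inv_div_of_tendsto_zero (hc : c < 1)
    (hupp : Tendsto (fun n : ℕ => (n : ℝ) ^ (-c) * α n) atTop (𝓝 0)) :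
    SuperpolynomialDecay atTop (fun n : ℕ => Real.log n) fun n => ((n : ℝ) / α n)⁻¹ := by
  refine (superpolynomialDecay_mul_isBigO_one
    (superpolynomialDecay_natCast_rpow_neg (sub_pos.2 hc)) (hupp.isBigO_one ℝ)).congr' ?_
  filter_upwards [eventually_gt_atTop 0] with n hn
  rw [← mul_assoc, ← Real.rpow_add (Nat.cast_pos.2 hn), inv_div, div_eq_inv_mul,
    ← Real.rpow_neg_one]
  ring_nf

theorem tendsto_div_atTop (hc₁ : c₁ < 1)
    (hlow : Tendsto (fun n : ℕ => (n : ℝ) ^ (-c₀) * α n) atTop atTop)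
    (hupp : Tendsto (fun n : ℕ => (n : ℝ) ^ (-c₁) * α n) atTop (𝓝 0)) :
    Tendsto (fun n : ℕ => (n : ℝ) / α n) atTop atTop := by
  have hinv : Tendsto (fun n : ℕ => ((n : ℝ) / α n)⁻¹) atTop (𝓝 0) := by
    simpa using superpolynomialDecay_inv_div_of_tendsto_zero hc₁ hupp 0
  refine (Tendsto.inv_tendsto_nhdsGT_zero (tendsto_nhdsWithin_iff.2 ⟨hinv, ?_⟩)).congr
    fun n => inv_inv _
  filter_upwards [hlow.eventually_gt_atTop 0, eventually_gt_atTop 0] with n hαn hn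
  have : (0 : ℝ) < α n := pos_of_mul_pos_right hαn (by positivity)
  exact Set.mem_Ioi.2 (by positivity)

theorem isBigO_log_length (hratio : Tendsto (fun n : ℕ => (n : ℝ) / α n) atTop atTop) :
    (fun n : ℕ => Real.log (α n)) =O[atTop] fun n => Real.log n := by
  refine IsBigO.of_bound' ?_
  filter_upwards [hratio.eventually_gt_atTop 1] with n hn
  obtain ⟨hα, hlt⟩ := pos_and_lt_of_one_lt_div hn
  rw [Real.norm_of_nonneg (Real.log_natCast_nonneg _),
    Real.norm_of_nonneg (Real.log_natCast_nonneg _)]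
  gcongr

theorem isBigO_log_ratio (hratio : Tendsto (fun n : ℕ => (n : ℝ) / α n) atTop atTop) :
    (fun n : ℕ => Real.log (n / α n)) =O[atTop] fun n => Real.log n := by
  refine ((isBigO_refl (fun n : ℕ => Real.log n) atTop).sub (isBigO_log_length hratio)).congr' ?_
    .rfl
  filter_upwards [hratio.eventually_gt_atTop 1] with n hn
  obtain ⟨hα, hlt⟩ := pos_and_lt_of_one_lt_div hn
  exact (Real.log_div (Nat.cast_ne_zero.2 (hα.trans hlt).ne') (Nat.cast_ne_zero.2 hα.ne')).symm

theorem superpolynomialDecay_inv_length (hc : 0 < c)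
    (hlow : Tendsto (fun n : ℕ => (n : ℝ) ^ (-c) * α n) atTop atTop)
    (hratio : Tendsto (fun n : ℕ => (n : ℝ) / α n) atTop atTop) :
    SuperpolynomialDecay atTop (fun n : ℕ => Real.log (n / α n)) fun n => (α n : ℝ)⁻¹ := by
  refine superpolynomialDecay_of_isBigO (superpolynomialDecay_natCast_rpow_neg hc)
    (isBigO_log_ratio hratio) (IsBigO.of_norm_eventuallyLE ?_)
  filter_upwards [hlow.eventually_ge_atTop 1, eventually_gt_atTop 0] with n hαn hn
  have : (0 : ℝ) < α n := pos_of_mul_pos_right (one_pos.trans_le hαn) (by positivity)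
  rwa [Real.norm_of_nonneg (by positivity), inv_le_iff_one_le_mul₀ this]

theorem superpolynomialDecay_log_length_div (hc : c < 1)
    (hupp : Tendsto (fun n : ℕ => (n : ℝ) ^ (-c) * α n) atTop (𝓝 0))
    (hratio : Tendsto (fun n : ℕ => (n : ℝ) / α n) atTop atTop) :
    SuperpolynomialDecay atTop (fun n : ℕ => Real.log (n / α n))
      fun n => Real.log (α n) / (n / α n) :=
  superpolynomialDecay_of_isBigO
    (superpolynomialDecay_inv_div_of_tendsto_zero hc hupp).param_mul (isBigO_log_ratio hratio)
    ((isBigO_log_length hratio).mul (isBigO_refl _ _))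

end PowerBounds

end CycleRestricted

theorem theorem2_general (α : ℕ → ℕ)
    (hratio : Tendsto (fun n : ℕ => (n : ℝ) / α n) atTop atTop)
    (hinv : SuperpolynomialDecay atTop (fun n : ℕ => Real.log (n / α n)) fun n => (α n : ℝ)⁻¹)
    (hlog : SuperpolynomialDecay atTop (fun n : ℕ => Real.log (n / α n))
      fun n => Real.log (α n) / (n / α n)) :
    CycleRestricted.IsAsymptoticExpansion atTop (CycleRestricted.mean α)
        0 (fun k => (k.factorial : ℝ))
        (fun k n => (n : ℝ) / (α n : ℝ) * (1 / CycleRestricted.xi ((n : ℝ) / (α n : ℝ)) ^ k)) ∧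
      CycleRestricted.IsAsymptoticExpansion atTop (CycleRestricted.var α)
        2 (fun k => (k.factorial : ℝ) - 1)
        (fun k n => (n : ℝ) / (α n : ℝ) * (1 / CycleRestricted.xi ((n : ℝ) / (α n : ℝ)) ^ k)) ∧
      CycleRestricted.var α =o[atTop] CycleRestricted.mean α := by
  have hregime := CycleRestricted.saddleRegime_saddle hratio hinv hlog
  have hmean := hregime.isAsymptoticExpansion_sum_pow_div
  have hvar := hregime.isAsymptoticExpansion_var
  exact ⟨hmean, hvar, hvar.isLittleO_of_lt hmean two_pos (by simp)⟩

theorem theorem2 (α : ℕ → ℕ) (α₀ α₁ : ℝ) (hα₀ : α₀ ∈ Set.Ioo (0 : ℝ) 1)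
    (hα₁ : α₁ ∈ Set.Ioo (0 : ℝ) 1)
    (hlow : Tendsto (fun n : ℕ => (n : ℝ) ^ (-α₀) * (α n : ℝ)) atTop atTop)
    (hupp : Tendsto (fun n : ℕ => (n : ℝ) ^ (-α₁) * (α n : ℝ)) atTop (𝓝 0)) :
    CycleRestricted.IsAsymptoticExpansion atTop (CycleRestricted.mean α)
        0 (fun k => (k.factorial : ℝ))
        (fun k n => (n : ℝ) / (α n : ℝ) * (1 / CycleRestricted.xi ((n : ℝ) / (α n : ℝ)) ^ k)) ∧
      CycleRestricted.IsAsymptoticExpansion atTop (CycleRestricted.var α)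
        2 (fun k => (k.factorial : ℝ) - 1)
        (fun k n => (n : ℝ) / (α n : ℝ) * (1 / CycleRestricted.xi ((n : ℝ) / (α n : ℝ)) ^ k)) ∧
      CycleRestricted.var α =o[atTop] CycleRestricted.mean α := by
  have hratio := CycleRestricted.tendsto_div_atTop hα₁.2 hlow hupp
  exact theorem2_general α hratio
    (CycleRestricted.superpolynomialDecay_inv_length hα₀.1 hlow hratio)
    (CycleRestricted.superpolynomialDecay_log_length_div hα₁.2 hupp hratio)
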